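/- Let $\mathbb{C}\{x_1,x_2\}$ be the ring of convergent power series. For a system of positive weights $\alpha=(p,q)$ and $u=\sum u_{ij}x_1^ix_2^j\neq 0$, let $\rho_\alpha(u)=\min\{pi+qj : u_{ij}\ne 0\}$, let $\mathrm{in}_\alpha(u)$ be the sum of the terms of $u$ of weight $\rho_\alpha(u)$, and for an ideal $I$ let $\mathrm{in}_\alpha(I)$ be the ideal of $\mathbb{C}\{x_1,x_2\}$ generated by the initial parts of the elements of $I$. An ideal has finite colength if its quotient ring has finite dimension over $\mathbb{C}$. Let $a,b,c,d$ be positive integers with $bc>ad$, and put $\alpha_1=(b,a)$, $\alpha_2=(d,c)$. Let $g_1,g_2\in\mathbb{C}\{x_1,x_2\}$ be such that $\rho_{\alpha_1}(g_1)>ab$ if $g_1\ne 0$, and $\rho_{\alpha_2}(g_2)>cd$ if $g_2\neq 0$. Put $$f_1=x_1^a+x_2^b+g_1,\qquad f_2=x_1^c+x_2^d+g_2,\qquad J=\frac{\partial f_1}{\partial x_1}\frac{\partial f_2}{\partial x_2}-\frac{\partial f_1}{\partial x_2}\frac{\partial f_2}{\partial x_1}.$$ Then the following hold. (1) $x_1^a$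 is a term of $f_1$ and $x_2^d$ is a term of $f_2$ (that is, their coefficients are nonzero). (2) $\rho_{\alpha_1}(f_1)=ab$. (3) $\rho_{\alpha_2}(f_2)=cd$. (4) $bc>ad$. (5) The ideals $\mathrm{in}_{\alpha_1}(\langle f_1,J\rangle)$ and $\langle \mathrm{in}_{\alpha_1}(f_1),\mathrm{in}_{\alpha_1}(J)\rangle$ are equal and of finite colength. (6) The ideals $\mathrm{in}_{\alpha_2}(\langle f_2,J\rangle)$ and $\langle \mathrm{in}_{\alpha_2}(f_2),\mathrm{in}_{\alpha_2}(J)\rangle$ are equal and of finite colength. If moreover $b>1$ and $c>1$, then all the assumptions of the main theorem are satisfied: $a,d\ge 1$, $b,c>1$, the weight systems $\alpha_1,\alpha_2$ are not collinear, and (1)–(6) hold. Finally, order $\mathbb{N}^2$ by $(i,j)<_1(i',j')$ if and only if $bi+aj>bi'+aj'$, or $bi+aj=bi'+aj'$ and $j>j'$. For $u\neq 0$ let $\exp(u)$ be the $<_1$-maximal exponent of a monomial occurring in $u$, and $\mathrm{cp}(u)$ the coefficient of that monomial. Define the S-function $$S(f_1,J)=\mathrm{cp}(J)\,x^{m-\exp(f_1)}f_1-\mathrm{cp}(f_1)\,x^{m-\exp(J)}J,$$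 where $m$ is the componentwise maximum of $\exp(f_1)$ and $\exp(J)$. Then $\{f_1,J,S(f_1,J)\}$ is a $<_1$-standard basis of $\langle f_1,J\rangle$: its members are nonzero elements of this ideal, and for every nonzero $u\in\langle f_1,J\rangle$ one has $\exp(u)\in\exp(v)+\mathbb{N}^2$ for some $v\in\{f_1,J,S(f_1,J)\}$. -/

import Mathlib

noncomputable section

namespace TwoFunctionGerms

open MvPowerSeries

/-- A power series in `x₁ = X 0`, `x₂ = X 1` is convergent if it converges absolutely on some
polydisc of radius `r > 0` around the origin. -/
def IsConvergent (u : MvPowerSeries (Fin 2) ℂ) : Prop :=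
  ∃ r : ℝ, 0 < r ∧ Summable fun n : Fin 2 →₀ ℕ => ‖coeff n u‖ * r ^ n.degree

theorem summable_of_le {u : MvPowerSeries (Fin 2) ℂ} {r s : ℝ} (hs : 0 < s) (hsr : s ≤ r)
    (h : Summable fun n : Fin 2 →₀ ℕ => ‖coeff n u‖ * r ^ n.degree) :
    Summable fun n : Fin 2 →₀ ℕ => ‖coeff n u‖ * s ^ n.degree := by
  refine Summable.of_nonneg_of_le (fun n => by positivity) (fun n => ?_) h
  gcongr

theorem IsConvergent.of_norm_le {u v : MvPowerSeries (Fin 2) ℂ} (hu : IsConvergent u)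
    (h : ∀ n, ‖coeff n v‖ ≤ ‖coeff n u‖) : IsConvergent v := by
  obtain ⟨r, hr, hs⟩ := hu
  refine ⟨r, hr, Summable.of_nonneg_of_le (fun n => by positivity) (fun n => ?_) hs⟩
  have := h n
  gcongr

theorem isConvergent_monomial (m : Fin 2 →₀ ℕ) (z : ℂ) : IsConvergent (monomial m z) := by
  classical
  refine ⟨1, one_pos, summable_of_ne_finset_zero (s := {m}) fun n hn => ?_⟩
  rw [coeff_monomial_ne (by simpa using hn)]
  simp

theorem IsConvergent.add {u v : MvPowerSeries (Fin 2) ℂ} (hu : IsConvergent u)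
    (hv : IsConvergent v) : IsConvergent (u + v) := by
  obtain ⟨r, hr, hu⟩ := hu
  obtain ⟨s, hs, hv⟩ := hv
  have hu' := summable_of_le (lt_min hr hs) (min_le_left r s) hu
  have hv' := summable_of_le (lt_min hr hs) (min_le_right r s) hv
  have h0 : 0 < min r s := lt_min hr hs
  refine ⟨min r s, h0, Summable.of_nonneg_of_le (fun n => by positivity) (fun n => ?_)
    (hu'.add hv')⟩
  rw [← add_mul, map_add]
  gcongr
  exact norm_add_le _ _

theorem IsConvergent.mul {u v : MvPowerSeries (Fin 2) ℂ} (hu : IsConvergent u)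
    (hv : IsConvergent v) : IsConvergent (u * v) := by
  classical
  obtain ⟨r, hr, hu⟩ := hu
  obtain ⟨s, hs, hv⟩ := hv
  have hu' := summable_of_le (lt_min hr hs) (min_le_left r s) hu
  have hv' := summable_of_le (lt_min hr hs) (min_le_right r s) hv
  have h0 : 0 < min r s := lt_min hr hs
  let F : (Fin 2 →₀ ℕ) → ℝ := fun n => ‖coeff n u‖ * min r s ^ n.degree
  let G : (Fin 2 →₀ ℕ) → ℝ := fun n => ‖coeff n v‖ * min r s ^ n.degree
  have hF : 0 ≤ F := fun n => by positivity
  have hG : 0 ≤ G := fun n => by positivity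
  have hFG : Summable fun x : (Fin 2 →₀ ℕ) × (Fin 2 →₀ ℕ) => F x.1 * G x.2 :=
    Summable.mul_of_nonneg (f := F) (g := G) hu' hv' hF hG
  have hm := summable_sum_mul_antidiagonal_of_summable_mul hFG
  refine ⟨min r s, h0, Summable.of_nonneg_of_le (fun n => by positivity) (fun n => ?_) hm⟩
  rw [coeff_mul]
  refine (mul_le_mul_of_nonneg_right (norm_sum_le _ _) (by positivity)).trans ?_
  rw [Finset.sum_mul]
  refine Finset.sum_le_sum fun k hk => le_of_eq ?_
  simp only [F, G]
  rw [← Finset.HasAntidiagonal.mem_antidiagonal.mp hk, map_add, pow_add, norm_mul]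
  ring

theorem IsConvergent.pderiv {u : MvPowerSeries (Fin 2) ℂ} (hu : IsConvergent u) (i : Fin 2) :
    IsConvergent (MvPowerSeries.pderiv ℂ i u) := by
  obtain ⟨r, hr, hu⟩ := hu
  have hinj : Function.Injective fun n : Fin 2 →₀ ℕ => n + Finsupp.single i 1 :=
    add_left_injective _
  have hs := (hu.comp_injective hinj).mul_left r⁻¹
  refine ⟨r / 2, by positivity, Summable.of_nonneg_of_le (fun n => by positivity)
    (fun n => ?_) hs⟩
  have h1 : ((n i : ℝ) + 1) ≤ 2 ^ n.degree := by
    have h2 : n i + 1 ≤ 2 ^ n.degree :=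
      (Nat.succ_le_of_lt (Nat.lt_two_pow_self)).trans
        (Nat.pow_le_pow_right (by norm_num) (Finsupp.le_degree i n))
    exact_mod_cast h2
  have h3 : ‖((n i : ℂ) + 1)‖ = (n i : ℝ) + 1 := by
    have : ((n i : ℂ) + 1) = ((n i + 1 : ℕ) : ℂ) := by push_cast; rfl
    rw [this, Complex.norm_natCast]
    push_cast
    rfl
  have h4 : (0 : ℝ) < 2 ^ n.degree := by positivity
  rw [coeff_pderiv, norm_mul, h3, div_pow]
  simp only [Function.comp_apply, map_add, Finsupp.degree_single, pow_succ]
  calc ‖coeff (n + Finsupp.single i 1) u‖ * ((n i : ℝ) + 1) * (r ^ n.degree / 2 ^ n.degree)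
      ≤ ‖coeff (n + Finsupp.single i 1) u‖ * 2 ^ n.degree * (r ^ n.degree / 2 ^ n.degree) := by
        gcongr
    _ = r⁻¹ * (‖coeff (n + Finsupp.single i 1) u‖ * (r ^ n.degree * r)) := by
        field_simp

/-- The ring `ℂ{x₁, x₂}` of convergent power series (germs of analytic functions at `0 ∈ ℂ²`). -/
def convergentSubalgebra : Subalgebra ℂ (MvPowerSeries (Fin 2) ℂ) where
  carrier := {u | IsConvergent u}
  mul_mem' := IsConvergent.mul
  add_mem' := IsConvergent.add
  algebraMap_mem' z := isConvergent_monomial 0 z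

/-- `ℂ{x₁, x₂}` as a type. -/
abbrev Germ : Type := convergentSubalgebra

/-- The coordinate germs; `coord 0 = x₁`, `coord 1 = x₂`. -/
def coord (i : Fin 2) : Germ :=
  ⟨X i, isConvergent_monomial (Finsupp.single i 1) 1⟩

/-- The partial derivative `∂u/∂xᵢ`. -/
def partialDeriv (i : Fin 2) (u : Germ) : Germ :=
  ⟨MvPowerSeries.pderiv ℂ i u.1, IsConvergent.pderiv u.2 i⟩

/-- The Jacobian determinant of `(f₁, f₂)`. -/
def jacobian (f₁ f₂ : Germ) : Germ :=
  partialDeriv 0 f₁ * partialDeriv 1 f₂ - partialDeriv 1 f₁ * partialDeriv 0 f₂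

/-- The Newton diagram of a germ: the exponents of the monomials that occur in it. -/
def newtonDiagram (u : Germ) : Set (Fin 2 →₀ ℕ) := {n | coeff n u.1 ≠ 0}

/-- `ρ_w(u)`: the least `w`-weight `w 0 * i + w 1 * j` of a monomial `x₁ⁱ x₂ʲ` occurring in `u`
(and `⊤` for `u = 0`). -/
def rho (w : Fin 2 → ℕ) (u : Germ) : ℕ∞ := weightedOrder w u.1

/-- The initial part `in_w(u)`: the `w`-homogeneous part of `u` of weight `ρ_w(u)`. -/
def initialPart (w : Fin 2 → ℕ) (u : Germ) : Germ :=
  ⟨weightedHomogeneousComponent w (rho w u).toNat u.1, by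
    refine IsConvergent.of_norm_le u.2 fun n => ?_
    rw [coeff_weightedHomogeneousComponent]
    split_ifs <;> simp⟩

/-- `in_w(I)`: the ideal generated by the initial parts of the elements of `I`. -/
def initialIdeal (w : Fin 2 → ℕ) (I : Ideal Germ) : Ideal Germ :=
  Ideal.span (initialPart w '' (I : Set Germ))

/-- Finite colength: the quotient ring has finite dimension over `ℂ`. -/
def HasFiniteColength (I : Ideal Germ) : Prop := FiniteDimensional ℂ (Germ ⧸ I)

/-- Hypotheses (1)–(6) on a pair of germs, for the weight systems `α₁ = (b, a)` and
`α₂ = (d, c)`. -/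
structure SatisfiesHypotheses (a b c d : ℕ) (f₁ f₂ : Germ) : Prop where
  /-- `x₁ᵃ` is a term of `f₁` and `x₂ᵈ` is a term of `f₂`. -/
  hyp1 : Finsupp.single 0 a ∈ newtonDiagram f₁ ∧ Finsupp.single 1 d ∈ newtonDiagram f₂
  hyp2 : rho ![b, a] f₁ = (a * b : ℕ)
  hyp3 : rho ![d, c] f₂ = (c * d : ℕ)
  hyp4 : a * d < b * c
  hyp5 : initialIdeal ![b, a] (Ideal.span {f₁, jacobian f₁ f₂}) =
      Ideal.span {initialPart ![b, a] f₁, initialPart ![b, a] (jacobian f₁ f₂)} ∧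
    HasFiniteColength (initialIdeal ![b, a] (Ideal.span {f₁, jacobian f₁ f₂}))
  hyp6 : initialIdeal ![d, c] (Ideal.span {f₂, jacobian f₁ f₂}) =
      Ideal.span {initialPart ![d, c] f₂, initialPart ![d, c] (jacobian f₁ f₂)} ∧
    HasFiniteColength (initialIdeal ![d, c] (Ideal.span {f₂, jacobian f₁ f₂}))

/-- All the assumptions under which the main theorem is stated: the standing ones on
`a, b, c, d` (the two weight systems being non-collinear) together with (1)–(6). -/
structure MainTheoremApplies (a b c d : ℕ) (f₁ f₂ : Germ) : Prop
    extends SatisfiesHypotheses a b c d f₁ f₂ where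
  a_pos : 0 < a
  d_pos : 0 < d
  one_lt_b : 1 < b
  one_lt_c : 1 < c
  not_collinear : LinearIndependent ℚ ![![(b : ℚ), (a : ℚ)], ![(d : ℚ), (c : ℚ)]]

/-- `m` precedes `n` in the local order of the weight system `w`:
`L(m) > L(n)`, or `L(m) = L(n)` and the `x₂`-exponent of `m` is greater than that of `n`. -/
def PrivLT (w : Fin 2 → ℕ) (m n : Fin 2 →₀ ℕ) : Prop :=
  Finsupp.weight w n < Finsupp.weight w m ∨
    (Finsupp.weight w m = Finsupp.weight w n ∧ n 1 < m 1)

open Classical in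
/-- The privileged exponent of `u ≠ 0`: the maximum of its Newton diagram for `PrivLT w`
(it exists and is unique as soon as the weights are positive; the value is `0` for `u = 0`). -/
def privExp (w : Fin 2 → ℕ) (u : Germ) : Fin 2 →₀ ℕ :=
  if h : ∃ n ∈ newtonDiagram u, ∀ m ∈ newtonDiagram u, m ≠ n → PrivLT w m n then h.choose else 0

/-- The maximum in the definition of `privExp` is really attained, at a unique point. -/
theorem existsUnique_privExp {w : Fin 2 → ℕ} (hw : ∀ i, 0 < w i) {u : Germ} (hu : u ≠ 0) :
    ∃! n, n ∈ newtonDiagram u ∧ ∀ m ∈ newtonDiagram u, m ≠ n → PrivLT w m n := by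
  have hne : (newtonDiagram u).Nonempty := by
    by_contra h
    refine hu (Subtype.ext (MvPowerSeries.ext fun n => ?_))
    by_contra hn
    exact h ⟨n, hn⟩
  let key : (Fin 2 →₀ ℕ) → ℕ ×ₗ ℕ := fun n => toLex (Finsupp.weight w n, n 1)
  have hmem := Function.argminOn_mem key (newtonDiagram u) hne
  have hmin : ∀ m ∈ newtonDiagram u, key (Function.argminOn key _ hne) ≤ key m :=
    fun m hm => Function.argminOn_le key _ hm
  generalize Function.argminOn key (newtonDiagram u) hne = n at hmem hmin
  have hpriv : ∀ m ∈ newtonDiagram u, m ≠ n → PrivLT w m n := by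
    intro m hm hmn
    rcases Prod.Lex.le_iff.mp (hmin m hm) with h | ⟨h, h'⟩
    · exact Or.inl h
    · refine Or.inr ⟨h.symm, lt_of_le_of_ne h' fun h1 => hmn ?_⟩
      replace h : Finsupp.weight w n = Finsupp.weight w m := h
      replace h1 : n 1 = m 1 := h1
      have hsum : ∀ k : Fin 2 →₀ ℕ, Finsupp.weight w k = k 0 * w 0 + k 1 * w 1 := fun k => by
        rw [Finsupp.weight_apply, Finsupp.sum_fintype _ _ (by simp)]
        simp
      rw [hsum, hsum, h1, add_left_inj] at h
      have h0 : n 0 = m 0 := Nat.eq_of_mul_eq_mul_right (hw 0) h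
      ext i
      fin_cases i
      · exact h0.symm
      · exact h1.symm
  refine ⟨n, ⟨hmem, hpriv⟩, fun n' hn' => ?_⟩
  by_contra hne'
  have h1 := hpriv n' hn'.1 hne'
  have h2 := hn'.2 n hmem (Ne.symm hne')
  unfold PrivLT at h1 h2
  omega

/-- The privileged coefficient. -/
def privCoeff (w : Fin 2 → ℕ) (u : Germ) : ℂ := coeff (privExp w u) u.1

/-- The germ `z x₁ⁱ x₂ʲ`, where `m = (i, j)`. -/
def monomialGerm (m : Fin 2 →₀ ℕ) (z : ℂ) : Germ := ⟨monomial m z, isConvergent_monomial m z⟩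

/-- The S-function of `u` and `v`: both are multiplied by a term that brings the privileged
term to the least common multiple of the privileged monomials, so that it cancels in the
difference. -/
def sFunction (w : Fin 2 → ℕ) (u v : Germ) : Germ :=
  monomialGerm ((privExp w u ⊔ privExp w v) - privExp w u) (privCoeff w v) * u -
    monomialGerm ((privExp w u ⊔ privExp w v) - privExp w v) (privCoeff w u) * v

/-- `G` is a standard basis of the ideal `I`: it consists of nonzero elements of `I`, and the
privileged exponent of each nonzero element of `I` lies in `exp(v) + ℕ²` for some `v ∈ G`. -/
def IsStandardBasis (w : Fin 2 → ℕ) (G : Set Germ) (I : Ideal Germ) : Prop :=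
  (∀ v ∈ G, v ∈ I ∧ v ≠ 0) ∧
    ∀ u ∈ I, u ≠ 0 → ∃ v ∈ G, ∃ k : Fin 2 →₀ ℕ, privExp w u = privExp w v + k

end TwoFunctionGerms

end

/-! Everything reduces to two leading forms. For α₁ = (b, a) the inequality ad < bc makes x₂ᵈ the
initial part of f₂, while that of f₁ is P = x₁ᵃ + x₂ᵇ. The Euler operators xᵢ∂ᵢ preserve weights, so
x₁x₂J has leading form (a x₁ᵃ)(d x₂ᵈ), the cross term vanishing because x₁∂₁x₂ᵈ = 0. Hence in(J) is
the monomial Q = ad x₁ᵃ⁻¹x₂ᵈ⁻¹ (`leadsWith_jacobian`). For α₂ the roles are exchanged: f₁ leads with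
x₁ᵃ, f₂ with x₁ᶜ + x₂ᵈ, and in(J) is the same monomial.

A sum of pure powers of both variables is a nonzerodivisor modulo Q
(`coeff_eq_zero_of_mul_purePowers`), so all syzygies of (P, Q) are Koszul. Therefore in u = Af + BJ
any cancellation of lowest terms can be removed by adding a multiple of the trivial relation (-J,
f), and in(u) lies in ⟨P, Q⟩ (`exists_initialPart_eq`). Finite colength holds because eliminating
one variable from P and Q leaves a pure power of the other.

For the standard basis, the S-function cancels x₁ᵃx₂ᵈ⁻¹ and leads with a multiple of x₂ᵇ⁺ᵈ⁻¹. It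
remains to see that an exponent of least x₂-degree in an element of ⟨P, Q⟩ is divisible by x₁ᵃ, by
x₁ᵃ⁻¹x₂ᵈ⁻¹ or by x₂ᵇ⁺ᵈ⁻¹ (`exponent_of_mem_span`). -/

noncomputable section

namespace TwoFunctionGerms

open MvPowerSeries

/-! ### Leading forms with respect to a weight -/

section LeadingForms

variable {σ R : Type*} [CommRing R]

/-- `P` is the `w`-homogeneous part of weight `s` of `f`, and `f` has no terms of smaller weight.
(`P = 0` is allowed.) -/
structure LeadsWith (w : σ → ℕ) (s : ℕ) (f P : MvPowerSeries σ R) : Prop where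
  coeff_eq : ∀ n, Finsupp.weight w n ≤ s → coeff n f = coeff n P
  coeff_eq_zero : ∀ n, Finsupp.weight w n ≠ s → coeff n P = 0

theorem LeadsWith.add {w : σ → ℕ} {s : ℕ} {f g P Q : MvPowerSeries σ R}
    (hf : LeadsWith w s f P) (hg : LeadsWith w s g Q) : LeadsWith w s (f + g) (P + Q) where
  coeff_eq n hn := by rw [map_add, map_add, hf.coeff_eq n hn, hg.coeff_eq n hn]
  coeff_eq_zero n hn := by rw [map_add, hf.coeff_eq_zero n hn, hg.coeff_eq_zero n hn, add_zero]

theorem LeadsWith.sub {w : σ → ℕ} {s : ℕ} {f g P Q : MvPowerSeries σ R}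
    (hf : LeadsWith w s f P) (hg : LeadsWith w s g Q) : LeadsWith w s (f - g) (P - Q) where
  coeff_eq n hn := by rw [map_sub, map_sub, hf.coeff_eq n hn, hg.coeff_eq n hn]
  coeff_eq_zero n hn := by rw [map_sub, hf.coeff_eq_zero n hn, hg.coeff_eq_zero n hn, sub_zero]

/-- The weight condition on the first factor is shifted by `s`, so that it makes sense for
`k < s` too. -/
theorem LeadsWith.shifted_mul {w : σ → ℕ} {s k : ℕ} {f P A A' : MvPowerSeries σ R}
    (hf : LeadsWith w s f P)
    (hA : ∀ n, s + Finsupp.weight w n ≤ k → coeff n A = coeff n A')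
    (hA' : ∀ n, s + Finsupp.weight w n ≠ k → coeff n A' = 0) :
    LeadsWith w k (A * f) (A' * P) := by
  classical
  constructor
  · intro n hn
    rw [coeff_mul, coeff_mul]
    refine Finset.sum_congr rfl fun p hp => ?_
    rw [← Finset.HasAntidiagonal.mem_antidiagonal.mp hp, map_add] at hn
    by_cases h : s + Finsupp.weight w p.1 ≤ k
    · rw [hA _ h]
      by_cases h2 : Finsupp.weight w p.2 ≤ s
      · rw [hf.coeff_eq _ h2]
      · rw [hA' p.1 (by omega), zero_mul, zero_mul]
    · rw [hf.coeff_eq _ (by omega), hf.coeff_eq_zero _ (by omega), mul_zero, mul_zero]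
  · intro n hn
    rw [coeff_mul]
    refine Finset.sum_eq_zero fun p hp => ?_
    rw [← Finset.HasAntidiagonal.mem_antidiagonal.mp hp, map_add] at hn
    by_cases h : s + Finsupp.weight w p.1 = k
    · rw [hf.coeff_eq_zero p.2 (by omega), mul_zero]
    · rw [hA' _ h, zero_mul]

theorem LeadsWith.mul {w : σ → ℕ} {s t : ℕ} {f g P Q : MvPowerSeries σ R}
    (hf : LeadsWith w s f P) (hg : LeadsWith w t g Q) :
    LeadsWith w (s + t) (f * g) (P * Q) :=
  hg.shifted_mul (fun n hn => hf.coeff_eq n (by omega))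
    (fun n hn => hf.coeff_eq_zero n (by omega))

theorem leadsWith_monomial (w : σ → ℕ) (m : σ →₀ ℕ) (z : R) :
    LeadsWith w (Finsupp.weight w m) (monomial m z) (monomial m z) where
  coeff_eq _ _ := rfl
  coeff_eq_zero n hn := coeff_monomial_ne (by rintro rfl; exact hn rfl) z

theorem leadsWith_zero {w : σ → ℕ} {s : ℕ} {f : MvPowerSeries σ R}
    (h : ∀ n, coeff n f ≠ 0 → s < Finsupp.weight w n) : LeadsWith w s f 0 where
  coeff_eq n hn := by
    by_contra h'
    exact absurd (h n h') (by omega)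
  coeff_eq_zero _ _ := rfl

theorem LeadsWith.of_monomial_mul {w : σ → ℕ} {s : ℕ} {m : σ →₀ ℕ} {f P : MvPowerSeries σ R}
    (h : LeadsWith w (Finsupp.weight w m + s) (monomial m 1 * f) (monomial m 1 * P)) :
    LeadsWith w s f P where
  coeff_eq n hn := by
    simpa [coeff_add_monomial_mul] using h.coeff_eq (m + n) (by rw [map_add]; omega)
  coeff_eq_zero n hn := by
    simpa [coeff_add_monomial_mul] using h.coeff_eq_zero (m + n) (by rw [map_add]; omega)

theorem coeff_X_mul_pderiv (i : σ) (f : MvPowerSeries σ R) (n : σ →₀ ℕ) :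
    coeff n (X i * MvPowerSeries.pderiv R i f) = n i * coeff n f := by
  classical
  rw [X, coeff_monomial_mul]
  split_ifs with h
  · have h1 : 1 ≤ n i := by simpa using h
    rw [coeff_pderiv, tsub_add_cancel_of_le h, one_mul, mul_comm]
    congr 1
    have : (n - Finsupp.single i 1 : σ →₀ ℕ) i + 1 = n i := by simp; omega
    exact_mod_cast congrArg (Nat.cast (R := R)) this
  · have h1 : n i = 0 := by
      by_contra h1
      exact h (by simpa using Nat.one_le_iff_ne_zero.mpr h1)
    simp [h1]

/-- The Euler operator is diagonal on monomials and so keeps every weight. The bare derivative would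
shift the weight by `w i`; the factor `X i` is cancelled at the end by `LeadsWith.of_monomial_mul`.
-/
theorem LeadsWith.X_mul_pderiv {w : σ → ℕ} {s : ℕ} {f P : MvPowerSeries σ R}
    (h : LeadsWith w s f P) (i : σ) :
    LeadsWith w s (X i * MvPowerSeries.pderiv R i f) (X i * MvPowerSeries.pderiv R i P) where
  coeff_eq n hn := by rw [coeff_X_mul_pderiv, coeff_X_mul_pderiv, h.coeff_eq n hn]
  coeff_eq_zero n hn := by rw [coeff_X_mul_pderiv, h.coeff_eq_zero n hn, mul_zero]

theorem X_mul_pderiv_monomial (i : σ) (m : σ →₀ ℕ) (z : R) :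
    X i * MvPowerSeries.pderiv R i (monomial m z) = monomial m (m i * z) := by
  classical
  ext n
  rw [coeff_X_mul_pderiv, coeff_monomial, coeff_monomial]
  split_ifs with h
  · rw [h]
  · rw [mul_zero]

/-- A sum of two pure powers of different variables is a nonzerodivisor in the following strong
sense: it suffices to look at coefficients of the product of bounded `j`-degree. -/
theorem coeff_eq_zero_of_pure_powers_mul {i j : σ} (hij : i ≠ j) {p q : ℕ} (hq : 0 < q)
    {A : MvPowerSeries σ R} (n : σ →₀ ℕ)
    (h : ∀ m : σ →₀ ℕ, m j ≤ n j → coeff m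
      ((monomial (Finsupp.single i p) 1 + monomial (Finsupp.single j q) 1) * A) = 0) :
    coeff n A = 0 := by
  classical
  induction hk : n j using Nat.strong_induction_on generalizing n with
  | _ k ih =>
    -- With P = xᵢᵖ + xⱼ^q, comparing coefficients at n + p eᵢ expresses A at n through PA there and
    -- A at n + p eᵢ - q eⱼ. The i-degree grows but the j-degree drops, so the induction runs on the
    -- latter.
    have h1 := h (Finsupp.single i p + n) (by simp [hij.symm])
    rw [add_mul, map_add, coeff_add_monomial_mul, one_mul, coeff_monomial_mul] at h1
    split_ifs at h1 with hle
    · have hqn : q ≤ n j := by simpa [hij] using hle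
      have hj : (Finsupp.single i p + n - Finsupp.single j q) j = n j - q := by simp [hij]
      rw [ih _ (by omega) (Finsupp.single i p + n - Finsupp.single j q)
        (fun m hm => h m (by omega)) hj, mul_zero, add_zero] at h1
      exact h1
    · rwa [add_zero] at h1

end LeadingForms

/-! ### Convergent germs and their initial parts -/

section Germs

theorem Germ.ext' {u v : Germ} (h : ∀ n, coeff n u.1 = coeff n v.1) : u = v :=
  Subtype.ext (MvPowerSeries.ext h)

open Classical in
/-- The sum of the terms of `u` whose exponents satisfy `p`. -/
def restrictTerms (p : (Fin 2 →₀ ℕ) → Prop) (u : Germ) : Germ :=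
  ⟨fun n => if p n then coeff n u.1 else 0, by
    refine IsConvergent.of_norm_le u.2 fun n => ?_
    change ‖(if p n then coeff n u.1 else 0 : ℂ)‖ ≤ _
    split_ifs <;> simp⟩

open Classical in
theorem coeff_restrictTerms (p : (Fin 2 →₀ ℕ) → Prop) (u : Germ) (n : Fin 2 →₀ ℕ) :
    coeff n (restrictTerms p u).1 = if p n then coeff n u.1 else 0 := rfl

/-- Shifting exponents by m changes the majorant series only by a constant factor on the same
polydisc, so the quotient converges. Its coefficients are recorded because the Koszul reduction has
to know its weights. -/
theorem exists_eq_monomialGerm_mul {m : Fin 2 →₀ ℕ} {u : Germ}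
    (h : ∀ n, coeff n u.1 ≠ 0 → m ≤ n) {z : ℂ} (hz : z ≠ 0) :
    ∃ v : Germ, u = monomialGerm m z * v ∧ ∀ n, coeff n v.1 = z⁻¹ * coeff (m + n) u.1 := by
  classical
  refine ⟨⟨fun n => z⁻¹ * coeff (m + n) u.1, ?_⟩, ?_, fun n => rfl⟩
  · obtain ⟨r, hr, hs⟩ := u.2
    have hs' := (hs.comp_injective (add_right_injective m)).mul_left (‖z⁻¹‖ * (r ^ m.degree)⁻¹)
    refine ⟨r, hr, hs'.congr fun n => ?_⟩
    change _ = ‖z⁻¹ * coeff (m + n) u.1‖ * _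
    simp only [Function.comp_apply, map_add, pow_add, norm_mul]
    field_simp
  · refine Germ.ext' fun n => ?_
    change _ = coeff n (monomial m z * _)
    rw [coeff_monomial_mul]
    split_ifs with hmn
    · change _ = z * (z⁻¹ * coeff (m + (n - m)) u.1)
      rw [add_tsub_cancel_of_le hmn, mul_inv_cancel_left₀ hz]
    · by_contra h'
      exact hmn (h n h')

theorem coord_pow (i : Fin 2) (k : ℕ) : coord i ^ k = monomialGerm (Finsupp.single i k) 1 :=
  Subtype.ext (by simpa [coord, monomialGerm] using X_pow_eq (R := ℂ) i k)

theorem monomialGerm_mul (m n : Fin 2 →₀ ℕ) (y z : ℂ) :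
    monomialGerm m y * monomialGerm n z = monomialGerm (m + n) (y * z) :=
  Subtype.ext (monomial_mul_monomial m n y z)

theorem LeadsWith.rho_eq {w : Fin 2 → ℕ} {s : ℕ} {f P : Germ} (h : LeadsWith w s f.1 P.1)
    (hP : P ≠ 0) : rho w f = s := by
  obtain ⟨n, hn⟩ : ∃ n, coeff n P.1 ≠ 0 := by
    by_contra! h0
    exact hP (Germ.ext' fun n => by simpa using h0 n)
  have hs : Finsupp.weight w n = s := by
    by_contra h'
    exact hn (h.coeff_eq_zero n h')
  rw [rho, weightedOrder_eq_nat]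
  refine ⟨⟨n, by rwa [h.coeff_eq n hs.le], hs⟩, fun m hm => ?_⟩
  rw [h.coeff_eq m hm.le, h.coeff_eq_zero m hm.ne]

theorem LeadsWith.initialPart_eq {w : Fin 2 → ℕ} {s : ℕ} {f P : Germ}
    (h : LeadsWith w s f.1 P.1) (hP : P ≠ 0) : initialPart w f = P := by
  classical
  refine Germ.ext' fun n => ?_
  change coeff n (weightedHomogeneousComponent w (rho w f).toNat f.1) = _
  rw [h.rho_eq hP, ENat.toNat_natCast, coeff_weightedHomogeneousComponent]
  split_ifs with hn
  · exact h.coeff_eq n hn.le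
  · exact (h.coeff_eq_zero n hn).symm

theorem leadsWith_initialPart (w : Fin 2 → ℕ) {u : Germ} (hu : u ≠ 0) :
    LeadsWith w (rho w u).toNat u.1 (initialPart w u).1 := by
  classical
  constructor
  · intro n hn
    rw [initialPart, coeff_weightedHomogeneousComponent]
    split_ifs with h
    · rfl
    · refine coeff_eq_zero_of_lt_weightedOrder (w := w) ?_
      have hfin : rho w u ≠ ⊤ := by
        rw [rho, Ne, weightedOrder_eq_top_iff]
        exact fun h0 => hu (Subtype.ext h0)
      change _ < rho w u
      rw [← ENat.natCast_toNat hfin]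
      exact_mod_cast lt_of_le_of_ne hn h
  · intro n hn
    rw [initialPart, coeff_weightedHomogeneousComponent, if_neg hn]

theorem initialPart_ne_zero (w : Fin 2 → ℕ) {u : Germ} (hu : u ≠ 0) : initialPart w u ≠ 0 := by
  intro h0
  have h := leadsWith_initialPart w hu
  have hne : u.1 ≠ 0 := fun h => hu (Subtype.ext h)
  obtain ⟨n, hn, hs⟩ := exists_coeff_ne_zero_and_weightedOrder w
    ((ne_zero_iff_weightedOrder_finite w).mp hne)
  rw [h.coeff_eq n (by rw [rho, ← hs]; simp), h0] at hn
  exact hn rfl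

theorem initialPart_zero (w : Fin 2 → ℕ) : initialPart w 0 = 0 :=
  Germ.ext' fun n => by simp [initialPart]

/-! ### Initial parts of combinations of a regular pair -/

/-- Koszul reduction: a combination of `f` and `J` can be rewritten so that the initial parts of
the two summands do not cancel, hence its initial part is a combination of those of `f` and
`J`. -/
theorem exists_initialPart_eq {w : Fin 2 → ℕ} {s : ℕ} {f J P : Germ} {m : Fin 2 →₀ ℕ} {z : ℂ}
    (hz : z ≠ 0) (hf : LeadsWith w s f.1 P.1)
    (hJ : LeadsWith w (Finsupp.weight w m) J.1 (monomialGerm m z).1)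
    (hreg : ∀ A : Germ, (∀ n, ¬ m ≤ n → coeff n (A * P).1 = 0) →
      ∀ n, ¬ m ≤ n → coeff n A.1 = 0)
    {u : Germ} (hu : u ∈ Ideal.span {f, J}) :
    ∃ A B : Germ, initialPart w u = A * P + B * monomialGerm m z := by
  classical
  set t := Finsupp.weight w m with ht
  rcases eq_or_ne u 0 with rfl | hu0
  · exact ⟨0, 0, by simp [initialPart_zero]⟩
  have hlead := leadsWith_initialPart w hu0
  have hin0 := initialPart_ne_zero w hu0
  set r := (rho w u).toNat
  obtain ⟨A₀, B₀, hAB⟩ := Ideal.mem_span_pair.mp hu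
  -- A' is the slice of A whose product with G has weight k; the rest of A contributes only from k +
  -- 1 on.
  have split : ∀ {s' : ℕ} {g G : Germ}, LeadsWith w s' g.1 G.1 → ∀ (k : ℕ) (A : Germ),
      (∀ n, coeff n A.1 ≠ 0 → k ≤ s' + Finsupp.weight w n) → ∃ A' : Germ,
        (∀ n, coeff n A'.1 ≠ 0 → s' + Finsupp.weight w n = k) ∧
        (∀ n, coeff n (A - A').1 ≠ 0 → k + 1 ≤ s' + Finsupp.weight w n) ∧
        LeadsWith w k (A * g).1 (A' * G).1 := by
    intro s' g G hg k A hA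
    refine ⟨restrictTerms (fun n => s' + Finsupp.weight w n = k) A, fun n hn => ?_,
      fun n hn => ?_, hg.shifted_mul (fun n hn => ?_) fun n hn => ?_⟩
    · rw [coeff_restrictTerms] at hn
      by_contra h
      exact hn (if_neg h)
    · have e : coeff n (A - restrictTerms (fun n => s' + Finsupp.weight w n = k) A).1 =
        coeff n A.1 - coeff n (restrictTerms (fun n => s' + Finsupp.weight w n = k) A).1 := rfl
      rw [e, coeff_restrictTerms] at hn
      split_ifs at hn with h
      · simp at hn
      · have := hA n (by simpa using hn)
        omega
    · rw [coeff_restrictTerms]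
      split_ifs with h
      · rfl
      · by_contra h'
        have := hA n h'
        omega
    · rw [coeff_restrictTerms, if_neg hn]
  -- Both summands are pushed up to weight r, the weight of u. Only finitely many corrections occur,
  -- so no limit of germs has to be taken.
  have step : ∀ k ≤ r, ∃ A B : Germ, A * f + B * J = u ∧
      (∀ n, coeff n A.1 ≠ 0 → k ≤ s + Finsupp.weight w n) ∧
      (∀ n, coeff n B.1 ≠ 0 → k ≤ t + Finsupp.weight w n) := by
    intro k
    induction k with
    | zero => exact fun _ => ⟨A₀, B₀, hAB, fun _ _ => Nat.zero_le _, fun _ _ => Nat.zero_le _⟩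
    | succ k ih =>
      intro hk
      obtain ⟨A, B, hu', hA, hB⟩ := ih (by omega)
      obtain ⟨A', hA1, hA2, hA3⟩ := split hf k A hA
      obtain ⟨B', hB1, hB2, hB3⟩ := split hJ k B hB
      have hsum := hA3.add hB3
      -- Since k < r, the germ u has no terms of weight k, so the two slices form a syzygy of the
      -- leading forms.
      have hzero : A' * P + B' * monomialGerm m z = 0 := by
        refine Germ.ext' fun n => ?_
        change coeff n ((A' * P).1 + (B' * monomialGerm m z).1) = 0
        by_cases hn : Finsupp.weight w n = k
        · rw [← hsum.coeff_eq n hn.le]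
          change coeff n (A * f + B * J).1 = 0
          rw [hu', hlead.coeff_eq n (by omega), hlead.coeff_eq_zero n (by omega)]
        · exact hsum.coeff_eq_zero n hn
      have hA'm : ∀ n, coeff n A'.1 ≠ 0 → m ≤ n := by
        intro n hn
        by_contra hmn
        refine hn (hreg A' (fun l hl => ?_) n hmn)
        rw [eq_neg_of_add_eq_zero_left hzero]
        change coeff l (-(B'.1 * monomial m z)) = 0
        rw [map_neg, coeff_mul_monomial, if_neg hl, neg_zero]
      obtain ⟨h, hh, hc⟩ := exists_eq_monomialGerm_mul hA'm hz
      have hQ : monomialGerm m z ≠ 0 := by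
        intro h0
        have := congrArg (fun v : Germ => coeff m v.1) h0
        simp [monomialGerm, hz] at this
      have hB' : B' = -(h * P) := by
        refine mul_right_cancel₀ hQ ?_
        linear_combination hzero - P * hh
      -- Written additively because k may be smaller than s + t, in which case h = 0.
      have hdeg : ∀ n, coeff n h.1 ≠ 0 → s + t + Finsupp.weight w n = k := by
        intro n hn
        rw [hc] at hn
        have := hA1 _ (right_ne_zero_of_mul hn)
        rw [map_add] at this
        omega
      -- One bound serves both corrections: for J it is used with s' = t, for f with s' = s, and s'
      -- then cancels on both sides.
      have remainder : ∀ {s' : ℕ} {g G : Germ}, LeadsWith w s' g.1 G.1 → ∀ n,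
          coeff n (h * (g - G)).1 ≠ 0 → k + s' + 1 ≤ s + t + Finsupp.weight w n := by
        intro s' g G hg n hn
        change coeff n (h.1 * (g.1 - G.1)) ≠ 0 at hn
        rw [coeff_mul] at hn
        obtain ⟨p, hp, hp0⟩ := Finset.exists_ne_zero_of_sum_ne_zero hn
        have h1 := hdeg p.1 (left_ne_zero_of_mul hp0)
        have h2 : s' < Finsupp.weight w p.2 := by
          by_contra h2
          refine right_ne_zero_of_mul hp0 ?_
          rw [map_sub, hg.coeff_eq _ (by omega), sub_self]
        rw [← Finset.HasAntidiagonal.mem_antidiagonal.mp hp, map_add]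
        omega
      refine ⟨A - h * J, B + h * f, by linear_combination hu', fun n hn => ?_, fun n hn => ?_⟩
      · have e : A - h * J = (A - A') - h * (J - monomialGerm m z) := by
          linear_combination hh
        rw [e] at hn
        replace hn : coeff n (A - A').1 - coeff n (h * (J - monomialGerm m z)).1 ≠ 0 := hn
        by_cases h1 : coeff n (A - A').1 = 0
        · have := remainder hJ n fun h2 => hn (by rw [h1, h2, sub_zero])
          omega
        · exact hA2 n h1
      · have e : B + h * f = (B - B') + h * (f - P) := by
          linear_combination hB'
        rw [e] at hn
        replace hn : coeff n (B - B').1 + coeff n (h * (f - P)).1 ≠ 0 := hn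
        by_cases h1 : coeff n (B - B').1 = 0
        · have := remainder hf n fun h2 => hn (by rw [h1, h2, add_zero])
          omega
        · exact hB2 n h1
  obtain ⟨A, B, hu', hA, hB⟩ := step r le_rfl
  obtain ⟨A', -, -, hA3⟩ := split hf r A hA
  obtain ⟨B', -, -, hB3⟩ := split hJ r B hB
  have hsum := hA3.add hB3
  refine ⟨A', B', Germ.ext' fun n => ?_⟩
  change _ = coeff n ((A' * P).1 + (B' * monomialGerm m z).1)
  by_cases hn : Finsupp.weight w n = r
  · rw [← hsum.coeff_eq n hn.le, ← hlead.coeff_eq n hn.le, ← hu']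
    rfl
  · rw [hlead.coeff_eq_zero n hn, hsum.coeff_eq_zero n hn]

/-- Modulo I a germ equals its truncation to the N × N box of exponents: the remaining terms split
into those divisible by x₁^N and others divisible by x₂^N, and each group factors as a single
product in the ring. So finitely many monomials span the quotient. -/
theorem hasFiniteColength_of_coord_pow_mem {I : Ideal Germ} {N : ℕ}
    (h : ∀ i, coord i ^ N ∈ I) : HasFiniteColength I := by
  classical
  let e : Fin N × Fin N → (Fin 2 →₀ ℕ) := fun p =>
    Finsupp.single 0 (p.1 : ℕ) + Finsupp.single 1 (p.2 : ℕ)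
  let S : Finset (Fin 2 →₀ ℕ) := Finset.univ.image e
  have hS : ∀ n : Fin 2 →₀ ℕ, n 0 < N → n 1 < N → n ∈ S := by
    intro n h0 h1
    refine Finset.mem_image.mpr ⟨(⟨n 0, h0⟩, ⟨n 1, h1⟩), Finset.mem_univ _, ?_⟩
    ext i
    fin_cases i <;> simp [e]
  have hmem : ∀ (i : Fin 2) (u : Germ), (∀ n, coeff n u.1 ≠ 0 → N ≤ n i) → u ∈ I := by
    intro i u hu
    obtain ⟨v, hv, -⟩ := exists_eq_monomialGerm_mul (m := Finsupp.single i N) (u := u)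
      (fun n hn => by simpa using hu n hn) one_ne_zero
    rw [hv, ← coord_pow]
    exact I.mul_mem_right _ (h i)
  let q := Ideal.Quotient.mkₐ ℂ I
  refine Module.finite_def.mpr (Submodule.fg_def.mpr
    ⟨(fun n => q (monomialGerm n 1)) '' (S : Set (Fin 2 →₀ ℕ)), S.finite_toSet.image _, ?_⟩)
  refine eq_top_iff.mpr fun x _ => ?_
  obtain ⟨u, rfl⟩ := Ideal.Quotient.mk_surjective x
  have hfin : ∀ n, coeff n (∑ l ∈ S, coeff l u.1 • monomialGerm l 1 : Germ).1 =
      if n ∈ S then coeff n u.1 else 0 := by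
    intro n
    have e1 : (∑ l ∈ S, coeff l u.1 • monomialGerm l 1 : Germ).1 =
        ∑ l ∈ S, coeff l u.1 • monomial l (1 : ℂ) := by
      rw [AddSubmonoidClass.coe_finsetSum]
      rfl
    rw [e1, map_sum]
    simp [coeff_monomial]
  have hdecomp : u - ∑ l ∈ S, coeff l u.1 • monomialGerm l 1 ∈ I := by
    set v := u - ∑ l ∈ S, coeff l u.1 • monomialGerm l 1 with hv
    have hv1 : ∀ n ∈ S, coeff n v.1 = 0 := by
      intro n hn
      change coeff n u.1 - coeff n (∑ l ∈ S, coeff l u.1 • monomialGerm l 1 : Germ).1 = 0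
      rw [hfin, if_pos hn, sub_self]
    have hsplit : v = restrictTerms (fun n => N ≤ n 0) v +
        restrictTerms (fun n => ¬ N ≤ n 0) v := by
      refine Germ.ext' fun n => ?_
      change _ = coeff n (restrictTerms (fun n => N ≤ n 0) v).1 +
        coeff n (restrictTerms (fun n => ¬ N ≤ n 0) v).1
      rw [coeff_restrictTerms, coeff_restrictTerms]
      by_cases h0 : N ≤ n 0 <;> simp [h0]
    rw [hsplit]
    refine I.add_mem (hmem 0 _ fun n hn => ?_) (hmem 1 _ fun n hn => ?_)
    · rw [coeff_restrictTerms] at hn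
      by_contra h'
      exact hn (if_neg h')
    · rw [coeff_restrictTerms] at hn
      by_contra h'
      refine hn ?_
      split_ifs with h0
      · rfl
      · exact hv1 n (hS n (by omega) (by omega))
  have hq : Ideal.Quotient.mk I u = ∑ l ∈ S, coeff l u.1 • q (monomialGerm l 1) := by
    rw [Ideal.Quotient.mk_eq_mk_iff_sub_mem _ _ |>.mpr hdecomp]
    change q _ = _
    rw [map_sum]
    simp only [map_smul]
  rw [hq]
  exact Submodule.sum_mem _ fun l hl =>
    Submodule.smul_mem _ _ (Submodule.subset_span ⟨l, hl, rfl⟩)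

/-! ### Privileged exponents -/

theorem privExp_eq {w : Fin 2 → ℕ} (hw : ∀ i, 0 < w i) {u : Germ} {n : Fin 2 →₀ ℕ}
    (hn : n ∈ newtonDiagram u) (h : ∀ m ∈ newtonDiagram u, m ≠ n → PrivLT w m n) :
    privExp w u = n := by
  have hu : u ≠ 0 := by
    rintro rfl
    exact hn rfl
  have hex : ∃ n ∈ newtonDiagram u, ∀ m ∈ newtonDiagram u, m ≠ n → PrivLT w m n := ⟨n, hn, h⟩
  rw [privExp, dif_pos hex]
  exact (existsUnique_privExp hw hu).unique hex.choose_spec ⟨hn, h⟩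

/-- The privileged exponent only depends on the initial part. -/
theorem LeadsWith.privExp_eq {w : Fin 2 → ℕ} (hw : ∀ i, 0 < w i) {s : ℕ} {f P : Germ}
    (h : LeadsWith w s f.1 P.1) {n : Fin 2 →₀ ℕ} (hn : coeff n P.1 ≠ 0)
    (hmax : ∀ m, coeff m P.1 ≠ 0 → m ≠ n → n 1 < m 1) : privExp w f = n := by
  have hhom : ∀ m, coeff m P.1 ≠ 0 → Finsupp.weight w m = s := fun m hm => by
    by_contra h'
    exact hm (h.coeff_eq_zero m h')
  have hns := hhom n hn
  refine TwoFunctionGerms.privExp_eq hw (n := n) ?_ fun m hm hmn => ?_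
  · change coeff n f.1 ≠ 0
    rwa [h.coeff_eq n hns.le]
  · replace hm : coeff m f.1 ≠ 0 := hm
    by_cases hms : Finsupp.weight w m ≤ s
    · rw [h.coeff_eq m hms] at hm
      exact Or.inr ⟨(hhom m hm).trans hns.symm, hmax m hm hmn⟩
    · exact Or.inl (by omega)

/-- All terms of the initial part have the same weight, so among them the local order only compares
x₂-degrees and prefers the least one. This is the minimality that `exponent_of_mem_span` needs. -/
theorem privExp_spec {w : Fin 2 → ℕ} (hw : ∀ i, 0 < w i) {u : Germ} (hu : u ≠ 0) :
    coeff (privExp w u) (initialPart w u).1 ≠ 0 ∧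
      ∀ m, coeff m (initialPart w u).1 ≠ 0 → privExp w u 1 ≤ m 1 := by
  have hlead := leadsWith_initialPart w hu
  obtain ⟨n, ⟨hn, hmax⟩, -⟩ := existsUnique_privExp hw hu
  rw [privExp_eq hw hn hmax]
  obtain ⟨l, hl⟩ : ∃ l, coeff l (initialPart w u).1 ≠ 0 := by
    by_contra! h0
    exact initialPart_ne_zero w hu (Germ.ext' fun n => by simpa using h0 n)
  have key : ∀ m, coeff m (initialPart w u).1 ≠ 0 →
      Finsupp.weight w n ≤ Finsupp.weight w m ∧
      (Finsupp.weight w n = Finsupp.weight w m → n 1 ≤ m 1) ∧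
      Finsupp.weight w m = (rho w u).toNat := by
    intro m hm
    have hms : Finsupp.weight w m = (rho w u).toNat := by
      by_contra h'
      exact hm (hlead.coeff_eq_zero m h')
    rcases eq_or_ne m n with rfl | hmn
    · exact ⟨le_rfl, fun _ => le_rfl, hms⟩
    · have := hmax m (by change coeff m u.1 ≠ 0; rwa [hlead.coeff_eq m hms.le]) hmn
      unfold PrivLT at this
      omega
  have hn' : coeff n (initialPart w u).1 ≠ 0 := by
    rw [← hlead.coeff_eq n ((key l hl).1.trans (key l hl).2.2.le)]
    exact hn
  exact ⟨hn', fun m hm => (key m hm).2.1 (((key n hn').2.2).trans (key m hm).2.2.symm)⟩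

end Germs

/-! ### Ideals generated by a sum of pure powers and a monomial -/

section PurePowers

/-- The germ `xᵢᵖ + xⱼ^q`. -/
def purePowers (i j : Fin 2) (p q : ℕ) : Germ :=
  monomialGerm (Finsupp.single i p) 1 + monomialGerm (Finsupp.single j q) 1

theorem lt_or_lt_of_not_le {i j : Fin 2} (hij : i ≠ j) {m n : Fin 2 →₀ ℕ} (h : ¬ m ≤ n) :
    n i < m i ∨ n j < m j := by
  by_contra! h'
  refine h fun k => ?_
  rcases (by omega : k = i ∨ k = j) with rfl | rfl
  · exact h'.1
  · exact h'.2

/-- This is the regularity behind the Koszul reduction. If n i < m i ≤ p, the term xᵢᵖ cannot reach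
n + q eⱼ, so the product has there exactly the coefficient of A at n. If n j < m j, the product
vanishes in all j-degrees up to n j, and the recursion on the j-degree applies. -/
theorem coeff_eq_zero_of_mul_purePowers {i j : Fin 2} (hij : i ≠ j) {p q : ℕ} (hq : 0 < q)
    {m : Fin 2 →₀ ℕ} (hm : m i ≤ p) {A : Germ}
    (h : ∀ n, ¬ m ≤ n → coeff n (A * purePowers i j p q).1 = 0) (n : Fin 2 →₀ ℕ)
    (hn : ¬ m ≤ n) : coeff n A.1 = 0 := by
  have h' : ∀ n, ¬ m ≤ n → coeff n
      ((monomial (Finsupp.single i p) 1 + monomial (Finsupp.single j q) 1) * A.1) = 0 :=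
    fun n hn => by rw [mul_comm]; exact h n hn
  rcases lt_or_lt_of_not_le hij hn with hi | hj
  · have h1 := h' (Finsupp.single j q + n) fun hle => by
      have := hle i
      simp [hij] at this
      omega
    rwa [add_mul, map_add, coeff_add_monomial_mul, coeff_monomial_mul, if_neg, zero_add,
      one_mul] at h1
    intro hle
    have : p ≤ n i := by simpa [hij] using hle
    omega
  · exact coeff_eq_zero_of_pure_powers_mul hij hq n fun l hl => h' l fun hle => by
      have := hle j
      omega

/-- The exponents of minimal `j`-degree of the elements of `⟨xᵢᵖ + xⱼ^q, xᵐ⟩`. -/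
theorem exponent_of_mem_span {i j : Fin 2} (hij : i ≠ j) {p q : ℕ} (hq : 0 < q)
    {m : Fin 2 →₀ ℕ} {z : ℂ} {u A B : Germ}
    (hu : u = A * purePowers i j p q + B * monomialGerm m z) {n : Fin 2 →₀ ℕ}
    (hn : coeff n u.1 ≠ 0) (hmin : ∀ l, coeff l u.1 ≠ 0 → n j ≤ l j) :
    p ≤ n i ∨ m ≤ n ∨ m j + q ≤ n j := by
  by_contra! hcon
  obtain ⟨hni, hmn, hnj⟩ := hcon
  have hcoeff : ∀ l, ¬ m ≤ l → coeff l u.1 = coeff l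
      ((monomial (Finsupp.single i p) 1 + monomial (Finsupp.single j q) 1) * A.1) := by
    intro l hl
    rw [hu, mul_comm A]
    change coeff l (_ + B.1 * monomial m z) = _
    rw [map_add, coeff_mul_monomial, if_neg hl, add_zero]
    rfl
  apply hn
  rw [hcoeff n hmn, add_mul, map_add, coeff_monomial_mul, if_neg, zero_add, coeff_monomial_mul]
  -- As n i < p, only xⱼ^q A contributes at n. The coefficient of A at n - q eⱼ vanishes: in
  -- j-degree at most n j - q < m j, the product agrees with u, and u has no terms there by
  -- minimality of n j, as q > 0.
  · split_ifs with hle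
    · have hqn : q ≤ n j := by simpa using hle
      rw [one_mul]
      refine coeff_eq_zero_of_pure_powers_mul (i := i) (p := p) hij hq _ fun l hl => ?_
      have hlj : l j ≤ n j - q := by simpa using hl
      rw [← hcoeff l fun hle => by have := hle j; omega]
      by_contra h0
      have := hmin l h0
      omega
    · rfl
  · simpa using hni

theorem coeff_purePowers (i j : Fin 2) (p q : ℕ) (n : Fin 2 →₀ ℕ) :
    coeff n (purePowers i j p q).1 =
      coeff n (monomial (Finsupp.single i p) (1 : ℂ)) +
        coeff n (monomial (Finsupp.single j q) 1) := rfl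

theorem coeff_single_purePowers {i j : Fin 2} (hij : i ≠ j) {p q : ℕ} (hp : 0 < p) :
    coeff (Finsupp.single i p) (purePowers i j p q).1 = 1 := by
  rw [coeff_purePowers, coeff_monomial_same, coeff_monomial_ne, add_zero]
  intro h
  have := DFunLike.congr_fun h i
  simp [hij] at this
  omega

theorem purePowers_ne_zero {i j : Fin 2} (hij : i ≠ j) {p q : ℕ} (hp : 0 < p) :
    purePowers i j p q ≠ 0 := by
  intro h
  have := coeff_single_purePowers hij (q := q) hp
  rw [h] at this
  simp at this

theorem monomialGerm_ne_zero (m : Fin 2 →₀ ℕ) {z : ℂ} (hz : z ≠ 0) : monomialGerm m z ≠ 0 := by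
  intro h
  have := congrArg (fun v : Germ => coeff m v.1) h
  simp [monomialGerm, hz] at this

theorem purePowers_comm (i j : Fin 2) (p q : ℕ) : purePowers i j p q = purePowers j i q p :=
  add_comm _ _

/-- Multiplying the sum by xⱼ to the power m j and subtracting a multiple of xᵐ, possible since m i
≤ p, leaves a pure power of xⱼ. Then xᵢᵖ lies in the radical, hence so does xᵢ. -/
theorem hasFiniteColength_span_purePowers {i j : Fin 2} (hij : i ≠ j) {p q : ℕ} (hq : 0 < q)
    {m : Fin 2 →₀ ℕ} (hm : m i ≤ p) {z : ℂ} (hz : z ≠ 0) :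
    HasFiniteColength (Ideal.span {purePowers i j p q, monomialGerm m z}) := by
  set I := Ideal.span {purePowers i j p q, monomialGerm m z} with hI
  have hP : purePowers i j p q ∈ I := Ideal.subset_span (by simp)
  have hQ : monomialGerm m z ∈ I := Ideal.subset_span (by simp)
  have hP' : purePowers i j p q = coord i ^ p + coord j ^ q := by
    rw [coord_pow, coord_pow]
    rfl
  have hmeq : Finsupp.single i (p - m i) + m =
      Finsupp.single i p + Finsupp.single j (m j) := by
    ext k
    rcases (by omega : k = i ∨ k = j) with rfl | rfl
    · simp [hij]; omega
    · simp [hij]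
  have hj : coord j ^ (q + m j) ∈ I := by
    have e : coord j ^ (q + m j) = monomialGerm (Finsupp.single j (m j)) 1 * purePowers i j p q
        - monomialGerm (Finsupp.single i (p - m i)) z⁻¹ * monomialGerm m z := by
      rw [monomialGerm_mul, hmeq, inv_mul_cancel₀ hz, hP', coord_pow, coord_pow, coord_pow,
        mul_add, monomialGerm_mul, monomialGerm_mul, Finsupp.single_add,
        add_comm (Finsupp.single i p), add_comm (Finsupp.single j q)]
      simp
    rw [e]
    exact I.sub_mem (I.mul_mem_left _ hP) (I.mul_mem_left _ hQ)
  have hjr : coord j ∈ I.radical := ⟨_, hj⟩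
  have hir : coord i ∈ I.radical := by
    refine I.radical_isRadical ⟨p, ?_⟩
    have e : coord i ^ p = purePowers i j p q - coord j ^ q := by
      rw [hP']
      ring
    rw [e]
    exact I.radical.sub_mem (Ideal.le_radical hP) (I.radical.pow_mem_of_mem hjr q hq)
  obtain ⟨M, hM⟩ := hir
  refine hasFiniteColength_of_coord_pow_mem (N := M + (q + m j)) fun k => ?_
  rcases (by omega : k = i ∨ k = j) with rfl | rfl
  · exact I.pow_mem_of_pow_mem hM (by omega)
  · exact I.pow_mem_of_pow_mem hj (by omega)

/-- If `f` and `J` have initial parts `xᵢᵖ + xⱼ^q` and `z xᵐ`, then these generate the initial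
ideal of `⟨f, J⟩`, which has finite colength. -/
theorem initialIdeal_span_pair {i j : Fin 2} (hij : i ≠ j) {p q : ℕ} (hp : 0 < p) (hq : 0 < q)
    {m : Fin 2 →₀ ℕ} (hm : m i ≤ p) {z : ℂ} (hz : z ≠ 0) {w : Fin 2 → ℕ} {s : ℕ} {f J : Germ}
    (hf : LeadsWith w s f.1 (purePowers i j p q).1)
    (hJ : LeadsWith w (Finsupp.weight w m) J.1 (monomialGerm m z).1) :
    initialIdeal w (Ideal.span {f, J}) = Ideal.span {initialPart w f, initialPart w J} ∧
      HasFiniteColength (initialIdeal w (Ideal.span {f, J})) := by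
  have hfi := hf.initialPart_eq (purePowers_ne_zero hij hp)
  have hJi := hJ.initialPart_eq (monomialGerm_ne_zero m hz)
  have heq : initialIdeal w (Ideal.span {f, J}) =
      Ideal.span {initialPart w f, initialPart w J} := by
    refine le_antisymm (Ideal.span_le.mpr ?_) (Ideal.span_le.mpr ?_)
    · rintro _ ⟨u, hu, rfl⟩
      obtain ⟨A, B, h⟩ := exists_initialPart_eq hz hf hJ
        (fun A => coeff_eq_zero_of_mul_purePowers hij hq hm) hu
      rw [hfi, hJi]
      exact Ideal.mem_span_pair.mpr ⟨A, B, h.symm⟩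
    · rintro _ (rfl | rfl)
      · exact Ideal.subset_span ⟨f, Ideal.subset_span (by simp), rfl⟩
      · exact Ideal.subset_span ⟨J, Ideal.subset_span (by simp), rfl⟩
  refine ⟨heq, ?_⟩
  rw [heq, hfi, hJi]
  exact hasFiniteColength_span_purePowers hij hq hm hz

end PurePowers

/-! ### The standard basis given by the S-function -/

section StandardBasis

theorem privExp_of_leadsWith_monomial {w : Fin 2 → ℕ} (hw : ∀ i, 0 < w i) {s : ℕ} {f : Germ}
    {m : Fin 2 →₀ ℕ} {z : ℂ} (hz : z ≠ 0) (h : LeadsWith w s f.1 (monomialGerm m z).1) :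
    privExp w f = m ∧ privCoeff w f = z := by
  classical
  have hms : Finsupp.weight w m = s := by
    by_contra h'
    have := h.coeff_eq_zero m h'
    simp [monomialGerm, hz] at this
  have he : privExp w f = m := by
    refine h.privExp_eq hw (by simpa [monomialGerm] using hz) fun l hl hlm => ?_
    exact absurd (coeff_monomial_ne hlm z) hl
  refine ⟨he, ?_⟩
  rw [privCoeff, he, h.coeff_eq m hms.le]
  simp [monomialGerm]

theorem privExp_of_leadsWith_purePowers {w : Fin 2 → ℕ} (hw : ∀ i, 0 < w i) {s p q : ℕ}
    (hp : 0 < p) (hq : 0 < q) {f : Germ} (h : LeadsWith w s f.1 (purePowers 0 1 p q).1) :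
    privExp w f = Finsupp.single 0 p ∧ privCoeff w f = 1 := by
  classical
  have h1 := coeff_single_purePowers (i := 0) (j := 1) (q := q) (by decide) hp
  have hs : Finsupp.weight w (Finsupp.single 0 p) = s := by
    by_contra h'
    rw [h.coeff_eq_zero _ h'] at h1
    simp at h1
  have he : privExp w f = Finsupp.single 0 p := by
    refine h.privExp_eq hw (by simp [h1]) fun l hl hlm => ?_
    rw [coeff_purePowers, coeff_monomial_ne hlm, zero_add, coeff_monomial] at hl
    have : l = Finsupp.single 1 q := by
      by_contra h'
      exact hl (if_neg h')
    simpa [this] using hq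
  refine ⟨he, ?_⟩
  rw [privCoeff, he, h.coeff_eq _ hs.le, h1]

/-- If `f` and `J` have initial parts `x₁ᵖ + x₂^q` and `z x₁ᵖ⁻¹ x₂ᵉ`, then `f`, `J` and their
S-function form a standard basis. -/
theorem isStandardBasis_sFunction {w : Fin 2 → ℕ} (hw : ∀ i, 0 < w i) {p q e s : ℕ} (hp : 0 < p)
    (hq : 0 < q) {z : ℂ} (hz : z ≠ 0) {f J : Germ}
    (hf : LeadsWith w s f.1 (purePowers 0 1 p q).1)
    (hJ : LeadsWith w (Finsupp.weight w (Finsupp.single 0 (p - 1) + Finsupp.single 1 e)) J.1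
      (monomialGerm (Finsupp.single 0 (p - 1) + Finsupp.single 1 e) z).1) :
    IsStandardBasis w {f, J, sFunction w f J} (Ideal.span {f, J}) := by
  set m : Fin 2 →₀ ℕ := Finsupp.single 0 (p - 1) + Finsupp.single 1 e with hm
  obtain ⟨hfe, hfc⟩ := privExp_of_leadsWith_purePowers hw hp hq hf
  obtain ⟨hJe, hJc⟩ := privExp_of_leadsWith_monomial hw hz hJ
  have hsup : Finsupp.single 0 p ⊔ m = Finsupp.single 0 p + Finsupp.single 1 e := by
    ext k
    fin_cases k <;> simp [hm]
  have hd1 : Finsupp.single 0 p ⊔ m - Finsupp.single 0 p = Finsupp.single 1 e := by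
    rw [hsup, add_tsub_cancel_left]
  have hd2 : Finsupp.single 0 p ⊔ m - m = Finsupp.single 0 1 := by
    rw [hsup]
    ext k
    fin_cases k
    · simp [hm]; omega
    · simp [hm]
  have hm1 : Finsupp.single 0 1 + m = Finsupp.single 1 e + Finsupp.single 0 p := by
    ext k
    fin_cases k
    · simp [hm]; omega
    · simp [hm]
  have hS : sFunction w f J =
      monomialGerm (Finsupp.single 1 e) z * f - monomialGerm (Finsupp.single 0 1) 1 * J := by
    rw [sFunction, hfe, hJe, hd1, hd2, hfc, hJc]
  have hs : Finsupp.weight w (Finsupp.single 0 p) = s := by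
    by_contra h'
    have h1 := coeff_single_purePowers (i := 0) (j := 1) (q := q) (by decide) hp
    rw [hf.coeff_eq_zero _ h'] at h1
    simp at h1
  -- The common term z x₁ᵖx₂ᵉ cancels, and z x₂ᵉ⁺^q survives from x₂ᵉ · x₂^q.
  have hSlead : LeadsWith w (Finsupp.weight w (Finsupp.single 1 e) + s) (sFunction w f J).1
      (monomialGerm (Finsupp.single 1 (e + q)) z).1 := by
    have h1 := (leadsWith_monomial w (Finsupp.single 1 e) z).mul hf
    have h2 := (leadsWith_monomial w (Finsupp.single 0 1) (1 : ℂ)).mul hJ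
    rw [← map_add, hm1, map_add, hs] at h2
    have h3 := h1.sub h2
    have e1 : monomialGerm (Finsupp.single 1 e) z * purePowers 0 1 p q -
        monomialGerm (Finsupp.single 0 1) 1 * monomialGerm m z =
        monomialGerm (Finsupp.single 1 (e + q)) z := by
      rw [purePowers, mul_add, monomialGerm_mul, monomialGerm_mul, monomialGerm_mul, hm1,
        ← Finsupp.single_add, mul_one, one_mul]
      simp
    rw [hS, ← e1]
    exact h3
  have hSe := (privExp_of_leadsWith_monomial hw hz hSlead).1
  have hne : ∀ {s : ℕ} {g G : Germ}, LeadsWith w s g.1 G.1 → G ≠ 0 → g ≠ 0 := by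
    rintro s g G h hG rfl
    have := h.rho_eq hG
    simp [rho] at this
  have hfI : f ∈ Ideal.span {f, J} := Ideal.subset_span (by simp)
  have hJI : J ∈ Ideal.span {f, J} := Ideal.subset_span (by simp)
  constructor
  · rintro v (rfl | rfl | rfl)
    · exact ⟨hfI, hne hf (purePowers_ne_zero (by decide) hp)⟩
    · exact ⟨hJI, hne hJ (monomialGerm_ne_zero _ hz)⟩
    · refine ⟨?_, hne hSlead (monomialGerm_ne_zero _ hz)⟩
      rw [hS]
      exact Ideal.sub_mem _ (Ideal.mul_mem_left _ _ hfI) (Ideal.mul_mem_left _ _ hJI)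
  · intro u hu hu0
    obtain ⟨A, B, hAB⟩ := exists_initialPart_eq hz hf hJ
      (fun A => coeff_eq_zero_of_mul_purePowers (by decide) hq (by simp [hm])) hu
    obtain ⟨h1, h2⟩ := privExp_spec hw hu0
    -- The three alternatives are divisibility by the privileged monomials of f, J and the
    -- S-function, since the x₂-exponent of m is e.
    rcases exponent_of_mem_span (by decide) hq hAB h1 h2 with h | h | h
    · refine ⟨f, by simp, privExp w u - privExp w f, (add_tsub_cancel_of_le ?_).symm⟩
      rw [hfe]
      simpa using h
    · refine ⟨J, by simp, privExp w u - privExp w J, (add_tsub_cancel_of_le ?_).symm⟩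
      rwa [hJe]
    · refine ⟨sFunction w f J, by simp, privExp w u - privExp w (sFunction w f J),
        (add_tsub_cancel_of_le ?_).symm⟩
      rw [hSe]
      rw [Finsupp.single_le_iff]
      simpa [hm] using h

end StandardBasis

/-! ### The leading form of the Jacobian -/

section Jacobian

theorem weight_pair (p q : ℕ) (n : Fin 2 →₀ ℕ) :
    Finsupp.weight ![p, q] n = n 0 * p + n 1 * q := by
  rw [Finsupp.weight_eq_sum]
  simp

/-- The initial part of the Jacobian when those of the Euler derivatives are monomials whose
cross term vanishes. -/
theorem leadsWith_jacobian {w : Fin 2 → ℕ} {s t a d : ℕ} (ha : 0 < a) (hd : 0 < d)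
    (hw : s + t = a * w 0 + d * w 1) {f g P Q : Germ}
    (hf : LeadsWith w s f.1 P.1) (hg : LeadsWith w t g.1 Q.1)
    (hlead : (X 0 * MvPowerSeries.pderiv ℂ 0 P.1) * (X 1 * MvPowerSeries.pderiv ℂ 1 Q.1) -
      (X 1 * MvPowerSeries.pderiv ℂ 1 P.1) * (X 0 * MvPowerSeries.pderiv ℂ 0 Q.1) =
        monomial (Finsupp.single 0 a + Finsupp.single 1 d) ((a : ℂ) * d)) :
    LeadsWith w (Finsupp.weight w (Finsupp.single 0 (a - 1) + Finsupp.single 1 (d - 1)))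
      (jacobian f g).1
      (monomialGerm (Finsupp.single 0 (a - 1) + Finsupp.single 1 (d - 1)) ((a : ℂ) * d)).1 := by
  -- This is the leading form of x₁x₂J. Positivity of a and d permits the division by x₁x₂ that
  -- follows.
  have h := ((hf.X_mul_pderiv 0).mul (hg.X_mul_pderiv 1)).sub
    ((hf.X_mul_pderiv 1).mul (hg.X_mul_pderiv 0))
  rw [hlead] at h
  have hsum : (Finsupp.single 0 1 + Finsupp.single 1 1 : Fin 2 →₀ ℕ) +
      (Finsupp.single 0 (a - 1) + Finsupp.single 1 (d - 1)) =
      Finsupp.single 0 a + Finsupp.single 1 d := by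
    ext k
    fin_cases k
    · simp; omega
    · simp; omega
  have hXY : (monomial (Finsupp.single 0 1 + Finsupp.single 1 1) 1 : MvPowerSeries (Fin 2) ℂ) =
      X 0 * X 1 := by
    rw [X, X, monomial_mul_monomial, one_mul]
  refine LeadsWith.of_monomial_mul (m := Finsupp.single 0 1 + Finsupp.single 1 1) ?_
  change LeadsWith w _ _ (_ * monomial _ _)
  rw [monomial_mul_monomial, one_mul, ← map_add, hsum]
  have hwt : Finsupp.weight w (Finsupp.single 0 a + Finsupp.single 1 d) = s + t := by
    rw [hw, map_add, Finsupp.weight_single, Finsupp.weight_single]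
    simp
  rw [hwt, hXY]
  convert h using 1
  change X 0 * X 1 * (MvPowerSeries.pderiv ℂ 0 f.1 * MvPowerSeries.pderiv ℂ 1 g.1 -
    MvPowerSeries.pderiv ℂ 1 f.1 * MvPowerSeries.pderiv ℂ 0 g.1) = _
  ring

theorem LeadsWith.add_of_lt_weight {w : Fin 2 → ℕ} {s : ℕ} {f P g : Germ}
    (hf : LeadsWith w s f.1 P.1) (hg : ∀ n, coeff n g.1 ≠ 0 → s < Finsupp.weight w n) :
    LeadsWith w s (f + g).1 P.1 := by
  have := hf.add (leadsWith_zero hg)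
  rwa [add_zero] at this

theorem lt_weight_of_lt_rho {w : Fin 2 → ℕ} {s : ℕ} {g : Germ}
    (h : g ≠ 0 → (s : ℕ∞) < rho w g) (n : Fin 2 →₀ ℕ) (hn : coeff n g.1 ≠ 0) :
    s < Finsupp.weight w n := by
  have hg : g ≠ 0 := by
    rintro rfl
    exact hn rfl
  exact_mod_cast (h hg).trans_le (weightedOrder_le w hn)

end Jacobian

end TwoFunctionGerms

end

/-! ### Verification for the given pair of germs -/

theorem mainTheorem2 (a b c d : ℕ) (ha : 0 < a) (hb : 0 < b) (hc : 0 < c) (hd : 0 < d)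
    (habcd : a * d < b * c) (g₁ g₂ f₁ f₂ : TwoFunctionGerms.Germ)
    (hg₁ : g₁ ≠ 0 → ((a * b : ℕ) : ℕ∞) < TwoFunctionGerms.rho ![b, a] g₁)
    (hg₂ : g₂ ≠ 0 → ((c * d : ℕ) : ℕ∞) < TwoFunctionGerms.rho ![d, c] g₂)
    (hf₁ : f₁ = TwoFunctionGerms.coord 0 ^ a + TwoFunctionGerms.coord 1 ^ b + g₁)
    (hf₂ : f₂ = TwoFunctionGerms.coord 0 ^ c + TwoFunctionGerms.coord 1 ^ d + g₂) :
    TwoFunctionGerms.SatisfiesHypotheses a b c d f₁ f₂ ∧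
    (1 < b → 1 < c → TwoFunctionGerms.MainTheoremApplies a b c d f₁ f₂) ∧
    TwoFunctionGerms.IsStandardBasis ![b, a]
      {f₁, TwoFunctionGerms.jacobian f₁ f₂,
        TwoFunctionGerms.sFunction ![b, a] f₁ (TwoFunctionGerms.jacobian f₁ f₂)}
      (Ideal.span {f₁, TwoFunctionGerms.jacobian f₁ f₂}) := by
  open TwoFunctionGerms MvPowerSeries in
  have hw₁ : ∀ n, coeff n g₁.1 ≠ 0 → a * b < n 0 * b + n 1 * a := fun n hn => by
    simpa only [weight_pair] using lt_weight_of_lt_rho hg₁ n hn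
  have hw₂ : ∀ n, coeff n g₂.1 ≠ 0 → c * d < n 0 * d + n 1 * c := fun n hn => by
    simpa only [weight_pair] using lt_weight_of_lt_rho hg₂ n hn
  have hmono : ∀ (w : Fin 2 → ℕ) (s : ℕ) (i : Fin 2) (k : ℕ), k * w i = s →
      LeadsWith w s (monomial (Finsupp.single i k) (1 : ℂ))
        (monomial (Finsupp.single i k) 1) := by
    rintro w s i k rfl
    have := leadsWith_monomial w (Finsupp.single i k) (1 : ℂ)
    rwa [Finsupp.weight_single, smul_eq_mul] at this
  have hbig : ∀ (w : Fin 2 → ℕ) (s : ℕ) (i : Fin 2) (k : ℕ), s < k * w i →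
      LeadsWith w s (monomial (Finsupp.single i k) (1 : ℂ)) 0 := by
    intro w s i k h
    classical
    refine leadsWith_zero fun n hn => ?_
    rw [coeff_monomial] at hn
    have : n = Finsupp.single i k := by
      by_contra h'
      exact hn (if_neg h')
    rwa [this, Finsupp.weight_single, smul_eq_mul]
  replace hf₁ : f₁ = purePowers 0 1 a b + g₁ := by rw [hf₁, coord_pow, coord_pow]; rfl
  replace hf₂ : f₂ = purePowers 0 1 c d + g₂ := by rw [hf₂, coord_pow, coord_pow]; rfl
  have lead₁₁ : LeadsWith ![b, a] (a * b) f₁.1 (purePowers 0 1 a b).1 := by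
    rw [hf₁]
    refine LeadsWith.add_of_lt_weight ((hmono _ _ _ _ ?_).add (hmono _ _ _ _ ?_)) fun n hn => ?_
    · simp
    · simp [mul_comm]
    · rw [weight_pair]; exact hw₁ n hn
  have lead₂₂ : LeadsWith ![d, c] (c * d) f₂.1 (purePowers 0 1 c d).1 := by
    rw [hf₂]
    refine LeadsWith.add_of_lt_weight ((hmono _ _ _ _ ?_).add (hmono _ _ _ _ ?_)) fun n hn => ?_
    · simp
    · simp [mul_comm]
    · rw [weight_pair]; exact hw₂ n hn
  have lead₁₂ : LeadsWith ![b, a] (a * d) f₂.1 (monomialGerm (Finsupp.single 1 d) 1).1 := by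
    rw [hf₂, ← zero_add (monomialGerm (Finsupp.single 1 d) 1)]
    refine LeadsWith.add_of_lt_weight (P := 0 + _)
      ((hbig _ _ _ _ ?_).add (hmono _ _ _ _ ?_)) fun n hn => ?_
    · simpa [mul_comm c b] using habcd
    · simp [mul_comm]
    · rw [weight_pair]
      -- For an exponent (i, j) of g₂: c(bi + aj) ≥ a(di + cj) > acd, by ad < bc and the weight
      -- bound on g₂; then c is cancelled.
      have h1 := hw₂ n hn
      refine lt_of_mul_lt_mul_left (a := c) ?_ (Nat.zero_le c)
      have h2 := Nat.mul_le_mul_left (n 0) habcd.le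
      nlinarith
  have lead₂₁ : LeadsWith ![d, c] (a * d) f₁.1 (monomialGerm (Finsupp.single 0 a) 1).1 := by
    rw [hf₁, ← add_zero (monomialGerm (Finsupp.single 0 a) 1)]
    refine LeadsWith.add_of_lt_weight (P := _ + 0)
      ((hmono _ _ _ _ ?_).add (hbig _ _ _ _ ?_)) fun n hn => ?_
    · simp
    · simpa using habcd
    · rw [weight_pair]
      have h1 := hw₁ n hn
      refine lt_of_mul_lt_mul_left (a := b) ?_ (Nat.zero_le b)
      have h2 := Nat.mul_le_mul_left (n 1) habcd.le
      nlinarith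
  have hz : (a : ℂ) * d ≠ 0 := by simp; omega
  have hJ₁ := leadsWith_jacobian ha hd (by simp; ring) lead₁₁ lead₁₂ (by
    simp only [purePowers, monomialGerm, Subalgebra.coe_add, map_add, mul_add,
      X_mul_pderiv_monomial]
    simp [monomial_mul_monomial])
  have hJ₂ := leadsWith_jacobian ha hd (by simp; ring) lead₂₁ lead₂₂ (by
    simp only [purePowers, monomialGerm, Subalgebra.coe_add, map_add, mul_add,
      X_mul_pderiv_monomial]
    simp [monomial_mul_monomial])
  have hyps : SatisfiesHypotheses a b c d f₁ f₂ := by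
    refine ⟨⟨?_, ?_⟩, lead₁₁.rho_eq (purePowers_ne_zero (by decide) ha),
      lead₂₂.rho_eq (purePowers_ne_zero (by decide) hc), habcd, ?_, ?_⟩
    · change coeff _ f₁.1 ≠ 0
      rw [lead₁₁.coeff_eq _ (by rw [weight_pair]; simp), coeff_single_purePowers (by decide) ha]
      exact one_ne_zero
    · change coeff _ f₂.1 ≠ 0
      rw [lead₂₂.coeff_eq _ (by rw [weight_pair]; simp [mul_comm]), purePowers_comm,
        coeff_single_purePowers (by decide) hd]
      exact one_ne_zero
    · exact initialIdeal_span_pair (by decide) ha hb (by simp) hz lead₁₁ hJ₁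
    -- The variables are swapped because the monomial's exponent must not exceed the pure power in
    -- the distinguished variable: d - 1 ≤ d holds for x₂, whereas a - 1 ≤ c may fail for x₁.
    · rw [purePowers_comm] at lead₂₂
      exact initialIdeal_span_pair (by decide) hd hc (by simp) hz lead₂₂ hJ₂
  refine ⟨hyps, fun hb1 hc1 => ⟨hyps, ha, hd, hb1, hc1, ?_⟩, ?_⟩
  · rw [LinearIndependent.pair_iff]
    intro x y hxy
    have h0 : x * b + y * d = 0 := by simpa using congrFun hxy 0
    have h1 : x * a + y * c = 0 := by simpa using congrFun hxy 1
    have hdet : (b * c - a * d : ℚ) ≠ 0 := by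
      have : (a * d : ℚ) < b * c := by exact_mod_cast habcd
      linarith
    constructor
    · refine (mul_eq_zero.mp ?_).resolve_right hdet
      linear_combination c * h0 - d * h1
    · refine (mul_eq_zero.mp ?_).resolve_right hdet
      linear_combination b * h1 - a * h0
  · exact isStandardBasis_sFunction (by intro i; fin_cases i <;> simpa) ha hb hz lead₁₁ hJ₁
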